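/- **Proposition (Pseudo-Poincaré inequality).** Let $\Gamma$ be an infinite, connected, locally finite graph with symmetric edge weights $\mu_{xy}=\mu_{yx}\ge 0$, where $\mu_{xy}>0$ if and only if $x$ and $y$ are neighbours ($x\sim y$). Put $\mu(x)=\sum_{y\sim x}\mu_{xy}$, let $d$ be the graph distance, $B(x,r)=\{y: d(x,y)\le r\}$ and $V_\mu(x,r)=\sum_{y\in B(x,r)}\mu(y)$. Let $P(x,y)=\mu_{xy}/\mu(x)$ be the transition probabilities of the natural random walk, $P_n(x,y)$ its $n$-step transition probabilities and $p_n(x,y)=P_n(x,y)/\mu(y)$ its heat kernel. Assume: 1. there is $C_\mu\ge 1$ with $C_\mu^{-1}\le\mu(x)\le C_\mu$ for all $x\in\Gamma$; 2. $V:[0,\infty)\to(0,\infty)$ is a strictly increasing continuous function and there are $C_D,C_h>1$ such that $V(2r)\le C_D V(r)$ and $C_h^{-1}V(r)\le V_\mu(x,r)\le C_hV(r)$ for all $x\in\Gamma$ and $r>0$; 3. $\gamma>1$ and there are $c,C_0>0$ such that for all $x,y\in\Gamma$ $$p_n(x,y)\le\frac{C_0}{V(n^{1/\gamma})}\exp\left[-\left(\frac{d(x,y)^\gamma}{C_0n}\right)^{\frac1{\gamma-1}}\right]\quad\text{for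 all integers } n\ge1,$$ $$p_n(x,y)+p_{n+1}(x,y)\ge\frac{c}{V(n^{1/\gamma})}\exp\left[-\left(\frac{d(x,y)^\gamma}{cn}\right)^{\frac1{\gamma-1}}\right]\quad\text{for all integers } n\ge\max(1,d(x,y));$$ 4. $\phi:[0,\infty)\to[1,\infty)$ is continuous and regularly varying of some index $\beta>0$, that is, $\phi(\lambda t)/\phi(t)\to\lambda^\beta$ as $t\to\infty$ for every $\lambda>0$; 5. $K$ is a Markov operator symmetric with respect to $\mu$, $Kf(x)=\sum_y k(x,y)f(y)\mu(y)$ with $k(x,y)=k(y,x)\ge0$ and $\sum_y k(x,y)\mu(y)=1$ for all $x$, and it satisfies $(J_\phi)$: there is $C_\phi>0$ such that for all $x,y\in\Gamma$ $$\frac{C_\phi^{-1}}{V(d(x,y))\,\phi(d(x,y))}\le k(x,y)\le\frac{C_\phi}{V(d(x,y))\,\phi(d(x,y))}.$$ For $f:\Gamma\to\mathbb R$ and $R>0$ let $f_R(x)=V_\mu(x,R)^{-1}\sum_{y\in B(x,R)}f(y)\mu(y)$. Let $\|\cdot\|_2$ and $\langle\cdot,\cdot\rangle$ be the norm and the inner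 product of the real space $\ell^2(\Gamma,\mu)$, and let $\mathcal E_K(f,f)=\langle(I-K)f,f\rangle$. Then there is a constant $C>0$ such that, for all $R>0$ and all $f\in\ell^2(\Gamma,\mu)$, one has $f-f_R\in\ell^2(\Gamma,\mu)$ and $$\|f-f_R\|_2^2\le C\left(\frac{R^\gamma}{\int_0^R\frac{s^{\gamma-1}\,ds}{\phi(s)}}\right)\mathcal E_K(f,f).$$ -/

import Mathlib

/-- The simple graph carried by a weight: two distinct vertices are joined when the weight between
them is positive. Loops are irrelevant for the graph distance and for connectedness. -/
def weightGraph {Γ : Type*} (w : Γ → Γ → ℝ) : SimpleGraph Γ :=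
  SimpleGraph.fromRel (fun x y => 0 < w x y)

/-- A connected, locally finite weighted graph, given by its symmetric non-negative edge weight;
`x` and `y` are neighbours iff the weight is positive. (Loops are permitted.) -/
structure WeightedGraph (Γ : Type*) where
  weight : Γ → Γ → ℝ
  weight_symm : ∀ x y, weight x y = weight y x
  weight_nonneg : ∀ x y, 0 ≤ weight x y
  locallyFinite : ∀ x, {y | 0 < weight x y}.Finite
  connected : (weightGraph weight).Connected

namespace WeightedGraph

variable {Γ : Type*} (G : WeightedGraph Γ)

/-- The neighbours of `x`. -/
noncomputable def nbrs (x : Γ) : Finset Γ := (G.locallyFinite x).toFinset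

/-- The vertex weight `μ(x) = ∑_{y ∼ x} μ_{xy}`. -/
noncomputable def mu (x : Γ) : ℝ := ∑ y ∈ G.nbrs x, G.weight x y

/-- The graph distance. -/
noncomputable def d (x y : Γ) : ℕ := (weightGraph G.weight).dist x y

theorem finite_ball_nat (x : Γ) (n : ℕ) : {y | G.d x y ≤ n}.Finite := by
  induction n with
  | zero =>
    refine (Set.finite_singleton x).subset fun y hy => ?_
    have h : (weightGraph G.weight).dist x y = 0 := Nat.le_zero.mp hy
    rcases SimpleGraph.dist_eq_zero_iff_eq_or_not_reachable.mp h with h | h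
    · exact h.symm
    · exact absurd (G.connected.preconnected x y) h
  | succ n ih =>
    refine (ih.union (ih.biUnion fun z _ => G.locallyFinite z)).subset fun y hy => ?_
    by_cases hxy : y = x
    · left
      simp [hxy, d]
    · right
      obtain ⟨p, hp⟩ := (G.connected.preconnected y x).exists_walk_length_eq_dist
      cases p with
      | nil => exact absurd rfl hxy
      | @cons _ z _ hadj q =>
        have hz : G.d x z ≤ n := by
          have h1 : (weightGraph G.weight).dist z x ≤ q.length := SimpleGraph.dist_le q
          have h2 : (weightGraph G.weight).dist x y ≤ n + 1 := hy
          rw [SimpleGraph.dist_comm] at h2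
          rw [SimpleGraph.Walk.length_cons] at hp
          change (weightGraph G.weight).dist x z ≤ n
          rw [SimpleGraph.dist_comm]
          omega
        refine Set.mem_biUnion (show z ∈ {y | G.d x y ≤ n} from hz) ?_
        have h := (SimpleGraph.fromRel_adj _ y z).mp hadj
        rcases h.2 with h | h
        · exact h.trans_eq (G.weight_symm y z)
        · exact h

theorem finite_ball (x : Γ) (r : ℝ) : {y | (G.d x y : ℝ) ≤ r}.Finite :=
  (G.finite_ball_nat x ⌊r⌋₊).subset fun _ hy => Nat.le_floor hy

/-- The closed ball `B(x, r) = {y : d(x, y) ≤ r}`. -/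
noncomputable def ball (x : Γ) (r : ℝ) : Finset Γ := (G.finite_ball x r).toFinset

/-- The volume `V_μ(x, r) = μ(B(x, r))`. -/
noncomputable def vol (x : Γ) (r : ℝ) : ℝ := ∑ y ∈ G.ball x r, G.mu y

/-- The transition probabilities `P(x, y) = μ_{xy} / μ(x)` of the natural random walk. -/
noncomputable def step (x y : Γ) : ℝ := G.weight x y / G.mu x

open Classical in
/-- The `n`-step transition probabilities `P_n(x, y)`; the steps from `x` go to neighbours of `x`. -/
noncomputable def stepN : ℕ → Γ → Γ → ℝ
  | 0, x, y => if x = y then 1 else 0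
  | n + 1, x, y => ∑ z ∈ G.nbrs x, G.step x z * stepN n z y

/-- The heat kernel `p_n(x, y) = P_n(x, y) / μ(y)`. -/
noncomputable def heat (n : ℕ) (x y : Γ) : ℝ := G.stepN n x y / G.mu y

/-- The measure `μ` is comparable to the counting measure. -/
def ComparableToCounting : Prop :=
  ∃ C : ℝ, 1 ≤ C ∧ ∀ x, C⁻¹ ≤ G.mu x ∧ G.mu x ≤ C

/-- Uniform volume doubling with volume function `V : [0, ∞) → (0, ∞)`
(only the values of `V` on `[0, ∞)` matter). -/
structure UniformVolumeDoubling (V : ℝ → ℝ) : Prop where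
  pos : ∀ r, 0 ≤ r → 0 < V r
  strictMono : StrictMonoOn V (Set.Ici 0)
  continuous : ContinuousOn V (Set.Ici 0)
  doubling : ∃ C : ℝ, 1 < C ∧ ∀ r, 0 < r → V (2 * r) ≤ C * V r
  homogeneous : ∃ C : ℝ, 1 < C ∧
    ∀ x r, 0 < r → C⁻¹ * V r ≤ G.vol x r ∧ G.vol x r ≤ C * V r

/-- The sub-Gaussian upper bound for the heat kernel with escape time exponent `γ`. -/
def SubGaussianUpper (V : ℝ → ℝ) (γ : ℝ) : Prop :=
  ∃ C : ℝ, 0 < C ∧ ∀ (x y : Γ) (n : ℕ), 1 ≤ n →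
    G.heat n x y ≤ C / V ((n : ℝ) ^ (1 / γ)) *
      Real.exp (-(((G.d x y : ℝ) ^ γ / (C * n)) ^ (1 / (γ - 1))))

/-- The sub-Gaussian lower bound for the heat kernel with escape time exponent `γ`. -/
def SubGaussianLower (V : ℝ → ℝ) (γ : ℝ) : Prop :=
  ∃ c : ℝ, 0 < c ∧ ∀ (x y : Γ) (n : ℕ), 1 ≤ n → G.d x y ≤ n →
    c / V ((n : ℝ) ^ (1 / γ)) *
      Real.exp (-(((G.d x y : ℝ) ^ γ / (c * n)) ^ (1 / (γ - 1)))) ≤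
        G.heat n x y + G.heat (n + 1) x y

/-- `f ∈ ℓ²(Γ, μ)`. -/
def MemL2 (f : Γ → ℝ) : Prop := Summable fun x => f x ^ 2 * G.mu x

/-- The squared norm of `ℓ²(Γ, μ)`. -/
noncomputable def normSq (f : Γ → ℝ) : ℝ := ∑' x, f x ^ 2 * G.mu x

/-- The inner product of `ℓ²(Γ, μ)`. -/
noncomputable def inner (f g : Γ → ℝ) : ℝ := ∑' x, f x * g x * G.mu x

/-- The average `f_R(x)` of `f` over the ball `B(x, R)`. -/
noncomputable def avg (f : Γ → ℝ) (R : ℝ) (x : Γ) : ℝ :=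
  1 / G.vol x R * ∑ y ∈ G.ball x R, f y * G.mu y

/-- A Markov operator on `Γ`, symmetric with respect to `μ`, given by its kernel `k` with respect
to `μ`. -/
structure SymmMarkov where
  ker : Γ → Γ → ℝ
  ker_nonneg : ∀ x y, 0 ≤ ker x y
  ker_symm : ∀ x y, ker x y = ker y x
  hasSum_one : ∀ x, HasSum (fun y => ker x y * G.mu y) 1

variable {G}

/-- The action `K f (x) = ∑_y k(x, y) f(y) μ(y)`. -/
noncomputable def SymmMarkov.apply (K : G.SymmMarkov) (f : Γ → ℝ) (x : Γ) : ℝ :=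
  ∑' y, K.ker x y * f y * G.mu y

/-- The Dirichlet form `𝓔_K(f, f) = ⟨(I - K) f, f⟩`. -/
noncomputable def SymmMarkov.energy (K : G.SymmMarkov) (f : Γ → ℝ) : ℝ :=
  G.inner (fun x => f x - K.apply f x) f

/-- The condition `(J_φ)`. -/
def SymmMarkov.JumpCondition (K : G.SymmMarkov) (V φ : ℝ → ℝ) : Prop :=
  ∃ C : ℝ, 0 < C ∧ ∀ x y,
    C⁻¹ * (1 / (V (G.d x y) * φ (G.d x y))) ≤ K.ker x y ∧
      K.ker x y ≤ C * (1 / (V (G.d x y) * φ (G.d x y)))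

end WeightedGraph

/-- `f` is regularly varying at infinity with index `β`: it is positive and measurable on some
half-line `[a, ∞)` and `f(l t) / f(t) → l ^ β` as `t → ∞`, for every `l > 0`. -/
def IsRegularlyVarying (f : ℝ → ℝ) (β : ℝ) : Prop :=
  (∃ a : ℝ, (∀ t, a ≤ t → 0 < f t) ∧ Measurable (Set.domRestrict (Set.Ici a) f)) ∧
    ∀ l : ℝ, 0 < l →
      Filter.Tendsto (fun t => f (l * t) / f t) Filter.atTop (nhds (l ^ β))

/-!
The inequality is obtained by comparing `K` with the natural random walk `P` observed at the dyadic
times `2 ^ j`. Let `θ = 2 ^ (1 / γ)`, so that `θ ^ j` is the spatial scale of the time `2 ^ j`, and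
let `E n` be the Dirichlet form of `P ^ n` at `f`.

* The sub-Gaussian upper bound gives `∑_j p_{2^j}(x, y) / φ(θ ^ j) ≤ C k(x, y)` for `x ≠ y`
  (`exists_sum_subGaussian_le`): the terms decay geometrically away from the scale
  `θ ^ j ≈ d(x, y)`. Hence `∑_j E (2 ^ j) / φ(θ ^ j) ≤ C 𝓔_K`
  (`WeightedGraph.exists_sum_energy_walk_le`). In particular `E 1 ≤ C 𝓔_K`.
* For every symmetric Markov operator `Q` one has `2 𝓔_Q - 𝓔_{Q²} = ‖f - Q f‖² ≥ 0`. Therefore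
  `E (2 ^ J) ≤ 2 ^ (J - j) E (2 ^ j)` (`WeightedGraph.energy_walk_two_pow_le`), and with the previous
  point `2 ^ (-J) (∑_{j ≤ J} 2 ^ j / φ(θ ^ j)) E (2 ^ J) ≤ C 𝓔_K`.
* The sum in brackets bounds `∫_0^{θ ^ J} s ^ (γ - 1) / φ(s) ds` from above
  (`exists_integral_le_sum`).
* For `2 ^ J ≈ R ^ γ` the sub-Gaussian lower bound says that `p_n + p_{n+1}`, `n = 2 ^ J`, dominates
  the averaging kernel of balls of radius `R`, so that `‖f - f_R‖² ≤ C (E n + E (n + 1))`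
  (`WeightedGraph.exists_normSq_sub_avg_le`). The form at the odd time `n + 1`, which `E n` alone does
  not control on a bipartite graph, is at most `2 E 1 + 2 E n`.

Regular variation enters through two consequences only: the ratio `φ(s) / φ(t)` is bounded as long
as `s / t` is (`IsRegularlyVarying.exists_ratio_le`), and `φ(θ ^ j)` grows geometrically
(`IsRegularlyVarying.exists_le_geometric`).
-/

namespace WeightedGraph

variable {Γ : Type*} {G : WeightedGraph Γ} {f g h : Γ → ℝ}

/-! ### The space `ℓ²(Γ, μ)` -/

theorem mu_nonneg (x : Γ) : 0 ≤ G.mu x :=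
  Finset.sum_nonneg fun y _ => G.weight_nonneg x y

theorem MemL2.summable_mul (hf : G.MemL2 f) (hg : G.MemL2 g) :
    Summable fun x => f x * g x * G.mu x := by
  refine Summable.of_norm_bounded (hf.add hg) fun x => ?_
  have h1 : |f x * g x| ≤ f x ^ 2 + g x ^ 2 := by
    rw [abs_le]
    constructor <;> nlinarith [sq_nonneg (f x + g x), sq_nonneg (f x - g x), sq_nonneg (f x),
      sq_nonneg (g x)]
  rw [Real.norm_eq_abs, abs_mul, abs_of_nonneg (mu_nonneg x), ← add_mul]
  exact mul_le_mul_of_nonneg_right h1 (mu_nonneg x)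

theorem MemL2.sub (hf : G.MemL2 f) (hg : G.MemL2 g) : G.MemL2 fun x => f x - g x := by
  have h := (hf.add hg).sub ((hf.summable_mul hg).mul_left 2)
  refine h.congr fun x => ?_
  ring

theorem inner_self (f : Γ → ℝ) : G.inner f f = G.normSq f :=
  tsum_congr fun x => by ring

theorem inner_comm (f g : Γ → ℝ) : G.inner f g = G.inner g f :=
  tsum_congr fun x => by ring

theorem normSq_nonneg (f : Γ → ℝ) : 0 ≤ G.normSq f :=
  tsum_nonneg fun x => mul_nonneg (sq_nonneg _) (mu_nonneg x)

theorem inner_sub_left (hf : G.MemL2 f) (hg : G.MemL2 g) (hh : G.MemL2 h) :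
    G.inner (fun x => f x - g x) h = G.inner f h - G.inner g h := by
  unfold inner
  rw [← (hf.summable_mul hh).tsum_sub (hg.summable_mul hh)]
  exact tsum_congr fun x => by ring

theorem inner_sub_right (hf : G.MemL2 f) (hg : G.MemL2 g) (hh : G.MemL2 h) :
    G.inner h (fun x => f x - g x) = G.inner h f - G.inner h g := by
  rw [inner_comm, inner_sub_left hf hg hh, inner_comm f, inner_comm g]

theorem normSq_sub (hf : G.MemL2 f) (hg : G.MemL2 g) :
    G.normSq (fun x => f x - g x) = G.normSq f - 2 * G.inner f g + G.normSq g := by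
  rw [← inner_self, inner_sub_left hf hg (hf.sub hg), inner_sub_right hf hg hf,
    inner_sub_right hf hg hg, inner_self, inner_self, inner_comm g f]
  ring

theorem two_mul_inner_le (hf : G.MemL2 f) (hg : G.MemL2 g) :
    2 * G.inner f g ≤ G.normSq f + G.normSq g := by
  have := normSq_sub hf hg
  have := normSq_nonneg (G := G) (fun x => f x - g x)
  linarith

theorem neg_two_mul_inner_le (hf : G.MemL2 f) (hg : G.MemL2 g) :
    -(2 * G.inner f g) ≤ G.normSq f + G.normSq g := by
  have h := two_mul_inner_le (G := G) (f := fun x => -f x) (g := g)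
    (by simpa [MemL2] using hf) hg
  simpa [inner, normSq, tsum_neg] using h

/-! ### Symmetric Markov operators and their Dirichlet forms -/

namespace SymmMarkov

variable (K : G.SymmMarkov)

/-- The weight `k(x, y) μ(x) μ(y)` that a symmetric Markov kernel puts on a pair of vertices. -/
noncomputable def pairWeight (p : Γ × Γ) : ℝ := K.ker p.1 p.2 * (G.mu p.1 * G.mu p.2)

theorem pairWeight_nonneg (p : Γ × Γ) : 0 ≤ K.pairWeight p :=
  mul_nonneg (K.ker_nonneg _ _) (mul_nonneg (mu_nonneg _) (mu_nonneg _))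

theorem pairWeight_swap (p : Γ × Γ) : K.pairWeight p.swap = K.pairWeight p := by
  simp only [pairWeight, Prod.fst_swap, Prod.snd_swap]
  rw [K.ker_symm, mul_comm (G.mu p.2)]

theorem hasSum_sq_fst_fiber (f : Γ → ℝ) (x : Γ) :
    HasSum (fun y => K.pairWeight (x, y) * f x ^ 2) (f x ^ 2 * G.mu x) := by
  have h := (K.hasSum_one x).mul_left (f x ^ 2 * G.mu x)
  rw [mul_one] at h
  refine h.congr_fun fun y => ?_
  simp only [pairWeight]
  ring

theorem summable_sq_fst (hf : G.MemL2 f) :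
    Summable fun p : Γ × Γ => K.pairWeight p * f p.1 ^ 2 := by
  rw [summable_prod_of_nonneg fun p => mul_nonneg (K.pairWeight_nonneg p) (sq_nonneg _)]
  refine ⟨fun x => (K.hasSum_sq_fst_fiber f x).summable, ?_⟩
  refine hf.congr fun x => ?_
  exact (K.hasSum_sq_fst_fiber f x).tsum_eq.symm

theorem tsum_sq_fst (hf : G.MemL2 f) :
    ∑' p : Γ × Γ, K.pairWeight p * f p.1 ^ 2 = G.normSq f := by
  rw [(K.summable_sq_fst hf).tsum_prod' fun x => (K.hasSum_sq_fst_fiber f x).summable]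
  exact tsum_congr fun x => (K.hasSum_sq_fst_fiber f x).tsum_eq

theorem summable_sq_snd (hf : G.MemL2 f) :
    Summable fun p : Γ × Γ => K.pairWeight p * f p.2 ^ 2 := by
  refine ((Equiv.prodComm Γ Γ).summable_iff.mpr (K.summable_sq_fst hf)).congr fun p => ?_
  simp [Function.comp, K.pairWeight_swap]

theorem tsum_sq_snd (hf : G.MemL2 f) :
    ∑' p : Γ × Γ, K.pairWeight p * f p.2 ^ 2 = G.normSq f := by
  rw [← K.tsum_sq_fst hf, ← (Equiv.prodComm Γ Γ).tsum_eq fun p => K.pairWeight p * f p.1 ^ 2]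
  refine tsum_congr fun p => ?_
  simp [K.pairWeight_swap]

theorem summable_mul (hf : G.MemL2 f) (hg : G.MemL2 g) :
    Summable fun p : Γ × Γ => K.pairWeight p * (f p.1 * g p.2) := by
  refine Summable.of_norm_bounded ((K.summable_sq_fst hf).add (K.summable_sq_snd hg)) fun p => ?_
  have h1 : |f p.1 * g p.2| ≤ f p.1 ^ 2 + g p.2 ^ 2 := by
    rw [abs_le]
    constructor <;> nlinarith [sq_nonneg (f p.1 + g p.2), sq_nonneg (f p.1 - g p.2),
      sq_nonneg (f p.1), sq_nonneg (g p.2)]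
  rw [Real.norm_eq_abs, abs_mul, abs_of_nonneg (K.pairWeight_nonneg p), ← mul_add]
  exact mul_le_mul_of_nonneg_left h1 (K.pairWeight_nonneg p)

theorem inner_apply (hf : G.MemL2 f) (hg : G.MemL2 g) :
    G.inner f (K.apply g) = ∑' p : Γ × Γ, K.pairWeight p * (f p.1 * g p.2) := by
  rw [(K.summable_mul hf hg).tsum_prod]
  refine tsum_congr fun x => ?_
  have : ∀ y, K.pairWeight (x, y) * (f x * g y) = f x * G.mu x * (K.ker x y * g y * G.mu y) :=
    fun y => by simp only [pairWeight]; ring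
  simp only [this, tsum_mul_left, apply]
  ring

theorem inner_apply_comm (hf : G.MemL2 f) (hg : G.MemL2 g) :
    G.inner f (K.apply g) = G.inner (K.apply f) g := by
  rw [inner_comm (K.apply f), K.inner_apply hf hg, K.inner_apply hg hf,
    ← (Equiv.prodComm Γ Γ).tsum_eq fun p => K.pairWeight p * (f p.1 * g p.2)]
  refine tsum_congr fun p => ?_
  simp only [Equiv.prodComm_apply, K.pairWeight_swap, Prod.fst_swap, Prod.snd_swap]
  ring

/-- Jensen's inequality for the probability weights `k(x, ·) μ`. -/
theorem sq_apply_le (x : Γ) (hs : Summable fun y => K.ker x y * G.mu y * f y ^ 2) :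
    K.apply f x ^ 2 ≤ ∑' y, K.ker x y * G.mu y * f y ^ 2 := by
  have hw : ∀ y, 0 ≤ K.ker x y * G.mu y := fun y => mul_nonneg (K.ker_nonneg _ _) (mu_nonneg _)
  have hs1 : Summable fun y => K.ker x y * f y * G.mu y := by
    refine Summable.of_norm_bounded (hs.add (K.hasSum_one x).summable) fun y => ?_
    have h1 : |f y| ≤ f y ^ 2 + 1 := by
      rw [abs_le]
      constructor <;> nlinarith [sq_nonneg (f y - 1), sq_nonneg (f y + 1)]
    have h2 : K.ker x y * f y * G.mu y = K.ker x y * G.mu y * f y := by ring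
    rw [h2, Real.norm_eq_abs, abs_mul, abs_of_nonneg (hw y)]
    nlinarith [mul_le_mul_of_nonneg_left h1 (hw y)]
  -- expand `∑ k(x, y) μ(y) (f y - K f x)² ≥ 0`
  have h := ((hs.hasSum.sub (hs1.hasSum.mul_left (2 * K.apply f x))).add
    ((K.hasSum_one x).mul_left (K.apply f x ^ 2)))
  have h' := h.congr_fun (g := fun y => K.ker x y * G.mu y * (f y - K.apply f x) ^ 2)
    fun y => by ring
  have h0 := h'.nonneg fun y => mul_nonneg (hw y) (sq_nonneg _)
  change 0 ≤ _ - 2 * K.apply f x * K.apply f x + _ at h0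
  nlinarith

/-- A symmetric Markov operator is a contraction of `ℓ²(Γ, μ)`. -/
theorem memL2_apply (hpos : ∀ x, 0 < G.mu x) (hf : G.MemL2 f) :
    G.MemL2 (K.apply f) ∧ G.normSq (K.apply f) ≤ G.normSq f := by
  have hs := K.summable_sq_snd hf
  have hfib : ∀ x, ∑' y, K.pairWeight (x, y) * f y ^ 2 =
      (∑' y, K.ker x y * G.mu y * f y ^ 2) * G.mu x := fun x => by
    rw [← tsum_mul_right]
    exact tsum_congr fun y => by simp only [pairWeight]; ring
  have hle : ∀ x, K.apply f x ^ 2 * G.mu x ≤ ∑' y, K.pairWeight (x, y) * f y ^ 2 := fun x => by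
    rw [hfib]
    refine mul_le_mul_of_nonneg_right (K.sq_apply_le x ?_) (mu_nonneg x)
    refine ((hs.prod_factor x).mul_left (G.mu x)⁻¹).congr fun y => ?_
    have := (hpos x).ne'
    simp only [pairWeight]
    field_simp
  have hmem : G.MemL2 (K.apply f) :=
    Summable.of_nonneg_of_le (fun x => mul_nonneg (sq_nonneg _) (mu_nonneg x)) hle hs.prod
  refine ⟨hmem, ?_⟩
  rw [← K.tsum_sq_snd hf, hs.tsum_prod]
  exact hmem.tsum_le_tsum hle hs.prod

theorem energy_eq (hpos : ∀ x, 0 < G.mu x) (hf : G.MemL2 f) :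
    K.energy f = G.normSq f - G.inner f (K.apply f) := by
  rw [energy, inner_sub_left hf (K.memL2_apply hpos hf).1 hf, inner_self, inner_comm f]

/-- The Dirichlet form as a double sum:
`𝓔_K(f, f) = ½ ∑_{x, y} k(x, y) (f x - f y)² μ(x) μ(y)`. -/
theorem hasSum_energy (hpos : ∀ x, 0 < G.mu x) (hf : G.MemL2 f) :
    HasSum (fun p : Γ × Γ => K.pairWeight p * (f p.1 - f p.2) ^ 2) (2 * K.energy f) := by
  have h := ((K.summable_sq_fst hf).hasSum.sub ((K.summable_mul hf hf).hasSum.mul_left 2)).add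
    (K.summable_sq_snd hf).hasSum
  rw [K.tsum_sq_fst hf, K.tsum_sq_snd hf, ← K.inner_apply hf hf] at h
  rw [K.energy_eq hpos hf]
  have e : 2 * (G.normSq f - G.inner f (K.apply f)) =
      G.normSq f - 2 * G.inner f (K.apply f) + G.normSq f := by ring
  rw [e]
  exact h.congr_fun fun p => by ring

theorem energy_nonneg (hpos : ∀ x, 0 < G.mu x) (hf : G.MemL2 f) : 0 ≤ K.energy f := by
  have := (K.hasSum_energy hpos hf).nonneg fun p =>
    mul_nonneg (K.pairWeight_nonneg p) (sq_nonneg (f p.1 - f p.2))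
  linarith

theorem normSq_sub_apply (hpos : ∀ x, 0 < G.mu x) (hf : G.MemL2 f) :
    G.normSq (fun x => f x - K.apply f x) =
      2 * K.energy f - (G.normSq f - G.normSq (K.apply f)) := by
  rw [normSq_sub hf (K.memL2_apply hpos hf).1, K.energy_eq hpos hf]
  ring

theorem normSq_sub_apply_le (hpos : ∀ x, 0 < G.mu x) (hf : G.MemL2 f) :
    G.normSq (fun x => f x - K.apply f x) ≤ 2 * K.energy f := by
  have := (K.memL2_apply hpos hf).2
  rw [K.normSq_sub_apply hpos hf]
  linarith

/-- If `L = K²`, then `2 𝓔_K(f, f) - 𝓔_L(f, f) = ‖f - K f‖² ≥ 0`. -/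
theorem energy_le_two_mul_of_apply_eq_sq (L : G.SymmMarkov) (hpos : ∀ x, 0 < G.mu x)
    (hL : L.apply f = K.apply (K.apply f)) (hf : G.MemL2 f) :
    L.energy f ≤ 2 * K.energy f := by
  have hm := (K.memL2_apply hpos hf).1
  have h1 := K.normSq_sub_apply hpos hf
  have h2 := normSq_nonneg (G := G) (fun x => f x - K.apply f x)
  rw [L.energy_eq hpos hf, hL, K.inner_apply_comm hf hm, inner_self]
  linarith

theorem energy_le_of_apply_eq_comp (K' L : G.SymmMarkov) (hpos : ∀ x, 0 < G.mu x)
    (hL : L.apply f = K'.apply (K.apply f)) (hf : G.MemL2 f) :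
    L.energy f ≤ 2 * K.energy f + 2 * K'.energy f := by
  have hm := (K.memL2_apply hpos hf).1
  have hm' := (K'.memL2_apply hpos hf).1
  -- `⟨f - K'K f, f⟩ = ⟨f - K f, f⟩ + ⟨f - K' f, f⟩ - ⟨f - K' f, f - K f⟩`
  have h1 := neg_two_mul_inner_le (hf.sub hm') (hf.sub hm)
  have h2 := K.normSq_sub_apply_le hpos hf
  have h3 := K'.normSq_sub_apply_le hpos hf
  rw [inner_sub_left hf hm' (hf.sub hm), inner_sub_right hf hm hf, inner_sub_right hf hm hm',
    inner_self, inner_comm (K'.apply f) f] at h1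
  have e1 := K.energy_eq hpos hf
  have e2 := K'.energy_eq hpos hf
  rw [L.energy_eq hpos hf, hL, K'.inner_apply_comm hf hm]
  linarith

end SymmMarkov

/-! ### The natural random walk as a symmetric Markov operator -/

theorem mem_nbrs {x y : Γ} : y ∈ G.nbrs x ↔ 0 < G.weight x y := by
  simp [nbrs]

theorem step_nonneg (x y : Γ) : 0 ≤ G.step x y :=
  div_nonneg (G.weight_nonneg x y) (mu_nonneg x)

theorem step_eq_zero_of_notMem {x y : Γ} (h : y ∉ G.nbrs x) : G.step x y = 0 := by
  have : G.weight x y = 0 := le_antisymm (not_lt.mp fun h' => h (mem_nbrs.mpr h'))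
    (G.weight_nonneg x y)
  simp [step, this]

theorem stepN_nonneg (n : ℕ) (x y : Γ) : 0 ≤ G.stepN n x y := by
  induction n generalizing x with
  | zero => simp only [stepN]; split_ifs <;> norm_num
  | succ n ih =>
    simp only [stepN]
    exact Finset.sum_nonneg fun z _ => mul_nonneg (step_nonneg _ _) (ih z)

variable (G) in
/-- The transition operator `P f(x) = ∑_{z ∼ x} P(x, z) f(z)`, as a finite sum. -/
noncomputable def transition (f : Γ → ℝ) (x : Γ) : ℝ := ∑ z ∈ G.nbrs x, G.step x z * f z

theorem hasSum_stepN_mul (f : Γ → ℝ) (n : ℕ) (x : Γ) :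
    HasSum (fun y => G.stepN n x y * f y) (G.transition^[n] f x) := by
  classical
  induction n generalizing x with
  | zero =>
    have h := hasSum_single (f := fun y => G.stepN 0 x y * f y) x fun y hy => by
      simp [stepN, hy.symm]
    simpa [stepN] using h
  | succ n ih =>
    rw [Function.iterate_succ_apply']
    have h := hasSum_sum (s := G.nbrs x) fun z _ => (ih z).mul_left (G.step x z)
    refine h.congr_fun fun y => ?_
    simp only [stepN, Finset.sum_mul, mul_assoc]

theorem transition_const (hpos : ∀ x, 0 < G.mu x) (c : ℝ) :
    G.transition (fun _ => c) = fun _ => c := by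
  funext x
  have h : ∑ z ∈ G.nbrs x, G.step x z = 1 := by
    simp only [step]
    rw [← Finset.sum_div]
    exact div_self (hpos x).ne'
  rw [transition, ← Finset.sum_mul, h, one_mul]

theorem hasSum_stepN (hpos : ∀ x, 0 < G.mu x) (n : ℕ) (x : Γ) :
    HasSum (fun y => G.stepN n x y) 1 := by
  have h := hasSum_stepN_mul (G := G) (fun _ => 1) n x
  rw [Function.iterate_fixed (transition_const hpos 1)] at h
  simpa using h

/-- The Chapman–Kolmogorov equation with the last step split off. -/
theorem stepN_succ_right (n : ℕ) (x y : Γ) :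
    G.stepN (n + 1) x y = ∑ z ∈ G.nbrs y, G.stepN n x z * G.step z y := by
  classical
  have hδ : ∀ m u, G.transition^[m] (Pi.single y 1) u = G.stepN m u y := fun m u => by
    refine (hasSum_stepN_mul (Pi.single y 1) m u).unique ?_
    have h := hasSum_single (f := fun v => G.stepN m u v * (Pi.single y (1 : ℝ) : Γ → ℝ) v) y
      fun v hv => by simp [hv]
    simpa using h
  have hP : ∀ z, G.transition (Pi.single y 1) z = G.step z y := fun z => by
    rw [transition]
    by_cases hz : y ∈ G.nbrs z
    · rw [Finset.sum_eq_single_of_mem y hz fun v _ hv => by simp [hv]]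
      simp
    · rw [step_eq_zero_of_notMem hz]
      refine Finset.sum_eq_zero fun v hv => ?_
      have : v ≠ y := fun h => hz (h ▸ hv)
      simp [this]
  have h := hasSum_stepN_mul (G := G) (G.transition (Pi.single y 1)) n x
  rw [← Function.iterate_succ_apply, hδ] at h
  simp only [hP] at h
  refine h.unique (hasSum_sum_of_ne_finset_zero fun z hz => ?_)
  rw [step_eq_zero_of_notMem, mul_zero]
  rwa [mem_nbrs, G.weight_symm, ← mem_nbrs]

theorem mu_mul_stepN_comm (hpos : ∀ x, 0 < G.mu x) (n : ℕ) (x y : Γ) :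
    G.mu x * G.stepN n x y = G.mu y * G.stepN n y x := by
  induction n generalizing x y with
  | zero =>
    by_cases h : x = y
    · rw [h]
    · simp [stepN, h, Ne.symm h]
  | succ n ih =>
    rw [stepN_succ_right n y x, stepN, Finset.mul_sum, Finset.mul_sum]
    refine Finset.sum_congr rfl fun z _ => ?_
    have hx := (hpos x).ne'
    have hz := (hpos z).ne'
    have h := ih z y
    have h' : G.stepN n z y = G.mu y * G.stepN n y z / G.mu z := by
      rw [← h]; field_simp
    rw [h', step, step, G.weight_symm z x]
    field_simp

/-- The `n`-step operator of the natural random walk; its kernel with respect to `μ` is the heat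
kernel `p_n`. -/
noncomputable def walk (hpos : ∀ x, 0 < G.mu x) (n : ℕ) : G.SymmMarkov where
  ker := G.heat n
  ker_nonneg x y := div_nonneg (stepN_nonneg n x y) (mu_nonneg y)
  ker_symm x y := by
    have h := mu_mul_stepN_comm hpos n x y
    have hx := (hpos x).ne'
    have hy := (hpos y).ne'
    rw [heat, heat, div_eq_div_iff hy hx]
    linarith
  hasSum_one x := by
    refine (hasSum_stepN hpos n x).congr_fun fun y => ?_
    exact div_mul_cancel₀ _ (hpos y).ne'

theorem walk_apply (hpos : ∀ x, 0 < G.mu x) (n : ℕ) (f : Γ → ℝ) :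
    (walk hpos n).apply f = G.transition^[n] f := by
  funext x
  rw [← (hasSum_stepN_mul f n x).tsum_eq]
  refine tsum_congr fun y => ?_
  have := (hpos y).ne'
  simp only [walk, heat]
  field_simp

theorem walk_add_apply (hpos : ∀ x, 0 < G.mu x) (m n : ℕ) (f : Γ → ℝ) :
    (walk hpos (m + n)).apply f = (walk hpos m).apply ((walk hpos n).apply f) := by
  simp only [walk_apply, Function.iterate_add_apply]

theorem energy_walk_add_le (hpos : ∀ x, 0 < G.mu x) (m n : ℕ) (hf : G.MemL2 f) :
    (walk hpos (m + n)).energy f ≤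
      2 * (walk hpos n).energy f + 2 * (walk hpos m).energy f :=
  SymmMarkov.energy_le_of_apply_eq_comp _ _ _ hpos (walk_add_apply hpos m n f) hf

/-- Along dyadic times the Dirichlet form of the `n`-step walk grows at most linearly in `n`. -/
theorem energy_walk_two_pow_le (hpos : ∀ x, 0 < G.mu x) (hf : G.MemL2 f) (j k : ℕ) :
    (walk hpos (2 ^ (j + k))).energy f ≤ 2 ^ k * (walk hpos (2 ^ j)).energy f := by
  induction k with
  | zero => simp
  | succ k ih =>
    have h2 : 2 ^ (j + (k + 1)) = 2 ^ (j + k) + 2 ^ (j + k) := by ring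
    have h := SymmMarkov.energy_le_two_mul_of_apply_eq_sq (walk hpos (2 ^ (j + k)))
      (walk hpos (2 ^ (j + (k + 1)))) hpos (by rw [h2]; exact walk_add_apply hpos _ _ f) hf
    calc _ ≤ _ := h
      _ ≤ 2 * (2 ^ k * (walk hpos (2 ^ j)).energy f) := by gcongr
      _ = _ := by ring

end WeightedGraph

/-! ### Regularly varying functions along geometric sequences -/

section RegularVariation

open Filter Topology

variable {φ : ℝ → ℝ} {β : ℝ}

/-- A local form of Karamata's uniform convergence theorem. By Baire's theorem one bound on
`φ(eᵘ t) / φ(t)`, valid for all large `t`, is shared by all `u` in some interval; translating this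
interval to the origin and iterating gives a bound for all `u` in a bounded set. -/
theorem IsRegularlyVarying.exists_ratio_le (hφ : IsRegularlyVarying φ β)
    (h1 : ∀ t, 0 ≤ t → 1 ≤ φ t) (hc : ContinuousOn φ (Set.Ici 0)) (l : ℝ) :
    ∃ M : ℝ, 1 ≤ M ∧ ∀ s t, 0 < t → t ≤ s → s ≤ l * t → φ s ≤ M * φ t ∧ φ t ≤ M * φ s := by
  have hpos : ∀ t, 0 ≤ t → 0 < φ t := fun t ht => one_pos.trans_le (h1 t ht)
  let F : ℕ → Set ℝ := fun k =>
    {u | ∀ t : ℝ, (k : ℝ) ≤ t → φ (Real.exp u * t) ≤ k * φ t ∧ φ t ≤ k * φ (Real.exp u * t)}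
  have hF : ∀ k, IsClosed (F k) := fun k => by
    have : F k = ⋂ t : Set.Ici (k : ℝ), {u | φ (Real.exp u * t) ≤ k * φ t ∧
        φ t ≤ k * φ (Real.exp u * t)} := by
      ext u
      simp [F]
    rw [this]
    refine isClosed_iInter fun t => ?_
    have ht : (0 : ℝ) ≤ t := (Nat.cast_nonneg k).trans t.2
    have hcont : Continuous fun u => φ (Real.exp u * t) :=
      hc.comp_continuous (by fun_prop) fun u => mul_nonneg (Real.exp_pos u).le ht
    exact (isClosed_le hcont continuous_const).inter
      (isClosed_le continuous_const (continuous_const.mul hcont))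
  have hU : ⋃ k, F k = Set.univ := by
    refine Set.eq_univ_of_forall fun u => Set.mem_iUnion.mpr ?_
    have hlim := hφ.2 (Real.exp u) (Real.exp_pos u)
    have hL : 0 < Real.exp u ^ β := Real.rpow_pos_of_pos (Real.exp_pos u) β
    obtain ⟨T, hT⟩ := eventually_atTop.mp
      ((hlim.eventually (lt_mem_nhds (half_lt_self hL))).and
        (hlim.eventually (gt_mem_nhds (lt_two_mul_self hL))))
    obtain ⟨k, hk⟩ := exists_nat_ge (max T (max (2 * Real.exp u ^ β) (2 / Real.exp u ^ β)))
    refine ⟨k, fun t ht => ?_⟩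
    have hk0 : (0 : ℝ) ≤ k := Nat.cast_nonneg k
    have ht0 : 0 ≤ t := hk0.trans ht
    obtain ⟨hlo, hhi⟩ := hT t (((le_max_left _ _).trans hk).trans ht)
    have hk1 := ((le_max_left _ _).trans (le_max_right _ _)).trans hk
    have hk2 := ((le_max_right _ _).trans (le_max_right _ _)).trans hk
    have hφt := hpos t ht0
    have hφu := hpos _ (mul_nonneg (Real.exp_pos u).le ht0)
    rw [lt_div_iff₀ hφt] at hlo
    rw [div_lt_iff₀ hφt] at hhi
    refine ⟨hhi.le.trans (by gcongr), ?_⟩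
    calc φ t = 2 / Real.exp u ^ β * (Real.exp u ^ β / 2 * φ t) := by field_simp
      _ ≤ 2 / Real.exp u ^ β * φ (Real.exp u * t) := by gcongr
      _ ≤ k * φ (Real.exp u * t) := by gcongr
  obtain ⟨k, p, hp⟩ := nonempty_interior_of_iUnion_of_closed hF hU
  obtain ⟨ε, hε, hball⟩ := Metric.isOpen_iff.mp isOpen_interior p hp
  have hball : Metric.ball p ε ⊆ F k := hball.trans interior_subset
  have hk0 : (0 : ℝ) ≤ k := Nat.cast_nonneg k
  set T : ℝ := Real.exp p * k with hTdef
  have hT0 : 0 ≤ T := by positivity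
  -- a bound for ratios `s / t` up to `exp (ε / 2)`
  have hshort : ∀ v τ : ℝ, 0 ≤ v → v ≤ ε / 2 → T ≤ τ →
      φ (Real.exp v * τ) ≤ k ^ 2 * φ τ ∧ φ τ ≤ k ^ 2 * φ (Real.exp v * τ) := by
    intro v τ hv hv' hτ
    obtain ⟨t, rfl⟩ : ∃ t, τ = Real.exp p * t :=
      ⟨τ / Real.exp p, by field_simp⟩
    have ht : (k : ℝ) ≤ t := le_of_mul_le_mul_left hτ (Real.exp_pos p)
    have hA := hball (Metric.mem_ball_self hε) t ht
    have hB := hball (show p + v ∈ Metric.ball p ε by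
      rw [Metric.mem_ball, Real.dist_eq, add_sub_cancel_left, abs_of_nonneg hv]; linarith) t ht
    have e : Real.exp v * (Real.exp p * t) = Real.exp (p + v) * t := by
      rw [Real.exp_add]; ring
    rw [e]
    constructor
    · calc _ ≤ k * φ t := hB.1
        _ ≤ k * (k * φ (Real.exp p * t)) := by gcongr; exact hA.2
        _ = _ := by ring
    · calc _ ≤ k * φ t := hA.1
        _ ≤ k * (k * φ (Real.exp (p + v) * t)) := by gcongr; exact hB.2
        _ = _ := by ring
  have hlong : ∀ (m : ℕ) (v τ : ℝ), 0 ≤ v → v ≤ m * (ε / 2) → T ≤ τ →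
      φ (Real.exp v * τ) ≤ (k ^ 2 : ℝ) ^ m * φ τ ∧
        φ τ ≤ (k ^ 2 : ℝ) ^ m * φ (Real.exp v * τ) := by
    intro m
    induction m with
    | zero =>
      intro v τ hv hv' _
      have : v = 0 := le_antisymm (by simpa using hv') hv
      simp [this]
    | succ m ih =>
      intro v τ hv hv' hτ
      push_cast at hv'
      have hm : (0 : ℝ) < m + 1 := by positivity
      set w : ℝ := v / (m + 1) with hw
      have hw0 : 0 ≤ w := by positivity
      have hvw : v = m * w + w := by rw [hw]; field_simp
      have hw' : w ≤ ε / 2 := by rw [hw, div_le_iff₀ hm]; linarith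
      have h2 := ih (m * w) τ (by positivity) (by gcongr) hτ
      have hτ' : T ≤ Real.exp (m * w) * τ :=
        hτ.trans (le_mul_of_one_le_left (hT0.trans hτ) (Real.one_le_exp (by positivity)))
      have h3 := hshort w (Real.exp (m * w) * τ) hw0 hw' hτ'
      have e : Real.exp w * (Real.exp (m * w) * τ) = Real.exp v * τ := by
        rw [hvw, Real.exp_add]; ring
      rw [e] at h3
      constructor
      · calc _ ≤ _ := h3.1
          _ ≤ (k : ℝ) ^ 2 * ((k ^ 2 : ℝ) ^ m * φ τ) := by gcongr; exact h2.1
          _ = _ := by ring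
      · calc _ ≤ _ := h2.2
          _ ≤ (k ^ 2 : ℝ) ^ m * ((k : ℝ) ^ 2 * φ (Real.exp v * τ)) := by gcongr; exact h3.2
          _ = _ := by ring
  obtain ⟨m, hm⟩ := exists_nat_ge (Real.log l / (ε / 2))
  rw [div_le_iff₀ (by positivity)] at hm
  -- for `t < T` both arguments stay in a compact interval
  obtain ⟨M₀, hM₀⟩ := (isCompact_Icc (a := (0 : ℝ)) (b := l * T)).bddAbove_image
    (hc.mono fun x hx => hx.1)
  refine ⟨max 1 (max M₀ ((k ^ 2 : ℝ) ^ m)), le_max_left _ _, fun s t ht hts hsl => ?_⟩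
  have hφt := hpos t ht.le
  have hφs := hpos s (ht.le.trans hts)
  have hl : 1 ≤ l := le_of_mul_le_mul_right (by linarith) ht
  rcases le_or_gt T t with hTt | hTt
  · have hst : 1 ≤ s / t := (one_le_div ht).mpr hts
    have h := hlong m (Real.log (s / t)) t (Real.log_nonneg hst)
      ((Real.log_le_log (by positivity) ((div_le_iff₀ ht).mpr hsl)).trans hm) hTt
    rw [Real.exp_log (by positivity), div_mul_cancel₀ _ ht.ne'] at h
    have hM : (k ^ 2 : ℝ) ^ m ≤ max 1 (max M₀ ((k ^ 2 : ℝ) ^ m)) :=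
      (le_max_right _ _).trans (le_max_right _ _)
    exact ⟨h.1.trans (by gcongr), h.2.trans (by gcongr)⟩
  · have hM : M₀ ≤ max 1 (max M₀ ((k ^ 2 : ℝ) ^ m)) :=
      (le_max_left _ _).trans (le_max_right _ _)
    have hsT : s ≤ l * T := hsl.trans (by gcongr)
    have hs := hM₀ (Set.mem_image_of_mem φ ⟨ht.le.trans hts, hsT⟩)
    have ht' := hM₀ (Set.mem_image_of_mem φ ⟨ht.le, hts.trans hsT⟩)
    have hM1 : 0 ≤ max 1 (max M₀ ((k ^ 2 : ℝ) ^ m)) := zero_le_one.trans (le_max_left _ _)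
    exact ⟨(hs.trans hM).trans (le_mul_of_one_le_right hM1 (h1 t ht.le)),
      (ht'.trans hM).trans (le_mul_of_one_le_right hM1 (h1 s (ht.le.trans hts)))⟩

/-- A positive sequence whose consecutive ratios have a limit above `1` grows at least
geometrically, from any starting index. -/
theorem exists_le_geometric_of_tendsto_ratio {a : ℕ → ℝ} (ha : ∀ j, 0 < a j) {L : ℝ} (hL : 1 < L)
    (h : Tendsto (fun j => a (j + 1) / a j) atTop (𝓝 L)) :
    ∃ r C : ℝ, 0 < r ∧ r < 1 ∧ 0 < C ∧ ∀ i k, a i ≤ C * r ^ k * a (i + k) := by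
  obtain ⟨ρ, hρ1, hρL⟩ := exists_between hL
  obtain ⟨N, hN⟩ := eventually_atTop.mp (h.eventually (lt_mem_nhds hρL))
  have hρ0 : 0 < ρ := one_pos.trans hρ1
  set g : ℕ → ℝ := fun j => a j / ρ ^ j with hg
  have hgpos : ∀ j, 0 < g j := fun j => div_pos (ha j) (pow_pos hρ0 j)
  have hmono : ∀ i, N ≤ i → ∀ k, g i ≤ g (i + k) := by
    intro i hi k
    induction k with
    | zero => exact le_rfl
    | succ k ih =>
      refine ih.trans ?_
      have h' := hN (i + k) (by omega)
      rw [lt_div_iff₀ (ha _)] at h'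
      simp only [hg]
      rw [← add_assoc, div_le_div_iff₀ (by positivity) (by positivity), pow_succ]
      nlinarith [pow_pos hρ0 (i + k)]
  set S := ∑ i ∈ Finset.range (N + 1), g i
  set T := ∑ i ∈ Finset.range (N + 1), (g i)⁻¹
  have hS : ∀ i ≤ N, g i ≤ S := fun i hi =>
    Finset.single_le_sum (f := g) (fun j _ => (hgpos j).le) (Finset.mem_range.mpr (by omega))
  have hT : ∀ i ≤ N, (g i)⁻¹ ≤ T := fun i hi =>
    Finset.single_le_sum (f := fun j => (g j)⁻¹) (fun j _ => (inv_pos.mpr (hgpos j)).le)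
      (Finset.mem_range.mpr (by omega))
  have hS0 : 0 < S := (hgpos 0).trans_le (hS 0 (Nat.zero_le _))
  have hT0 : 0 < T := (inv_pos.mpr (hgpos 0)).trans_le (hT 0 (Nat.zero_le _))
  have hT' : ∀ m, 1 ≤ T * g m := by
    intro m
    rcases le_total m N with hm | hm
    · have := hT m hm
      rwa [inv_le_iff_one_le_mul₀ (hgpos m)] at this
    · have h1 := hT N le_rfl
      rw [inv_le_iff_one_le_mul₀ (hgpos N)] at h1
      obtain ⟨k, rfl⟩ := Nat.exists_eq_add_of_le hm
      exact h1.trans (by gcongr; exact hmono N le_rfl k)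
  refine ⟨ρ⁻¹, S * T + 1, inv_pos.mpr hρ0, inv_lt_one_of_one_lt₀ hρ1, by positivity,
    fun i k => ?_⟩
  have key : g i ≤ (S * T + 1) * g (i + k) := by
    have hp := hgpos (i + k)
    rcases le_total i N with hi | hi
    · nlinarith [hS i hi, mul_le_mul_of_nonneg_left (hT' (i + k)) hS0.le]
    · nlinarith [hmono i hi k, mul_pos (mul_pos hS0 hT0) hp]
  simp only [hg] at key
  rw [div_le_iff₀ (pow_pos hρ0 i), pow_add] at key
  refine key.trans (le_of_eq ?_)
  rw [inv_pow]
  field_simp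

theorem IsRegularlyVarying.exists_le_geometric (hφ : IsRegularlyVarying φ β) (hβ : 0 < β)
    (h1 : ∀ t, 0 ≤ t → 1 ≤ φ t) {θ : ℝ} (hθ : 1 < θ) :
    ∃ r C : ℝ, 0 < r ∧ r < 1 ∧ 0 < C ∧ ∀ i k, φ (θ ^ i) ≤ C * r ^ k * φ (θ ^ (i + k)) := by
  have hθ0 : 0 < θ := one_pos.trans hθ
  refine exists_le_geometric_of_tendsto_ratio (a := fun j => φ (θ ^ j))
    (fun j => one_pos.trans_le (h1 _ (by positivity))) (Real.one_lt_rpow hθ hβ) ?_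
  have h := (hφ.2 θ hθ0).comp (tendsto_pow_atTop_atTop_of_one_lt hθ)
  refine h.congr fun j => ?_
  simp only [Function.comp, pow_succ']

/-- The integral of `s ^ (γ - 1) / φ(s)` is dominated by its dyadic sum. -/
theorem exists_integral_le_sum (hφ : IsRegularlyVarying φ β)
    (h1 : ∀ t, 0 ≤ t → 1 ≤ φ t) (hc : ContinuousOn φ (Set.Ici 0)) {γ θ : ℝ} (hγ : 1 < γ)
    (hθ : 1 < θ) (hθγ : θ ^ γ = 2) :
    ∃ C : ℝ, 0 < C ∧ ∀ J : ℕ, ∫ s in (0 : ℝ)..θ ^ J, s ^ (γ - 1) / φ s ≤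
      C * ∑ j ∈ Finset.range (J + 1), 2 ^ j / φ (θ ^ j) := by
  obtain ⟨M, hM1, hM⟩ := hφ.exists_ratio_le h1 hc θ
  have hθ0 : 0 < θ := one_pos.trans hθ
  have hpos : ∀ t, 0 ≤ t → 0 < φ t := fun t ht => one_pos.trans_le (h1 t ht)
  have hcont : ContinuousOn (fun s => s ^ (γ - 1) / φ s) (Set.Ici 0) :=
    (Real.continuous_rpow_const (by linarith)).continuousOn.div hc fun t ht => (hpos t ht).ne'
  have hint : ∀ a b, 0 ≤ a → 0 ≤ b →
      IntervalIntegrable (fun s => s ^ (γ - 1) / φ s) MeasureTheory.volume a b := fun a b ha hb =>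
    (hcont.mono fun x hx => (le_min ha hb).trans hx.1).intervalIntegrable
  have hp0 := hpos 1 zero_le_one
  refine ⟨φ 1 + 2 * M, by positivity, fun J => ?_⟩
  induction J with
  | zero =>
    have h := intervalIntegral.integral_mono_on zero_le_one (hint 0 1 le_rfl zero_le_one)
      (intervalIntegrable_const (c := (1 : ℝ))) fun s hs =>
        show s ^ (γ - 1) / φ s ≤ 1 from
          div_le_one_of_le₀ ((Real.rpow_le_one hs.1 hs.2 (by linarith)).trans (h1 s hs.1))
            (hpos s hs.1).le
    simp only [intervalIntegral.integral_const, sub_zero, smul_eq_mul, mul_one] at h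
    simp only [pow_zero, zero_add, Finset.range_one, Finset.sum_singleton]
    refine h.trans ?_
    rw [mul_one_div, le_div_iff₀ hp0]
    linarith
  | succ J ih =>
    rw [← intervalIntegral.integral_add_adjacent_intervals
      (hint 0 (θ ^ J) le_rfl (by positivity)) (hint _ (θ ^ (J + 1)) (by positivity) (by positivity)),
      Finset.sum_range_succ _ (J + 1), mul_add]
    refine add_le_add ih ?_
    have hle : θ ^ J ≤ θ ^ (J + 1) := pow_le_pow_right₀ hθ.le (Nat.le_succ J)
    have hJ0 : 0 < θ ^ J := by positivity
    have hJ := hpos (θ ^ (J + 1)) (by positivity)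
    have h := intervalIntegral.integral_mono_on hle
      (hint (θ ^ J) _ (by positivity) (by positivity))
      (intervalIntegrable_const (c := (θ ^ (J + 1)) ^ (γ - 1) * (M / φ (θ ^ (J + 1))))) fun s hs => by
        have hs0 : 0 < s := hJ0.trans_le hs.1
        have hr := (hM (θ ^ (J + 1)) s hs0 hs.2 (by
          rw [pow_succ']; exact mul_le_mul_of_nonneg_left hs.1 hθ0.le)).1
        have : 1 / φ s ≤ M / φ (θ ^ (J + 1)) := by
          rw [div_le_div_iff₀ (hpos s hs0.le) hJ]; linarith
        rw [div_eq_mul_one_div]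
        exact mul_le_mul (Real.rpow_le_rpow hs0.le hs.2 (by linarith)) this
          (one_div_nonneg.mpr (hpos s hs0.le).le) (by positivity)
    rw [intervalIntegral.integral_const, smul_eq_mul] at h
    refine h.trans ?_
    have e : θ ^ (J + 1) * (θ ^ (J + 1)) ^ (γ - 1) = 2 ^ (J + 1) := by
      rw [← Real.rpow_one_add' (by positivity) (by linarith), add_sub_cancel,
        ← Real.rpow_natCast, ← Real.rpow_mul hθ0.le, mul_comm, Real.rpow_mul hθ0.le, hθγ,
        Real.rpow_natCast]
    calc _ ≤ θ ^ (J + 1) * ((θ ^ (J + 1)) ^ (γ - 1) * (M / φ (θ ^ (J + 1)))) := by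
          gcongr; linarith
      _ = M * (2 ^ (J + 1) / φ (θ ^ (J + 1))) := by rw [← e]; ring
      _ ≤ _ := by gcongr; linarith

end RegularVariation

/-! ### Summing the sub-Gaussian bound over dyadic times -/

/-- Exponential growth is beaten by the sub-Gaussian factor at dyadic scales. -/
theorem exists_pow_mul_exp_neg_rpow_le {A C κ : ℝ} (hA : 0 ≤ A) (hC : 0 < C) (hκ : 0 < κ) :
    ∃ B : ℝ, 0 < B ∧ ∀ k : ℕ, A ^ k * Real.exp (-((2 ^ k / C) ^ κ)) ≤ B := by
  have h2κ : 1 < (2 : ℝ) ^ κ := Real.one_lt_rpow one_lt_two hκ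
  obtain ⟨N, hN⟩ := pow_unbounded_of_one_lt A h2κ
  refine ⟨N.factorial * (C ^ κ) ^ N, by positivity, fun k => ?_⟩
  set y : ℝ := (2 ^ k / C) ^ κ with hy
  have hCκ : 0 < C ^ κ := Real.rpow_pos_of_pos hC κ
  have hy0 : 0 ≤ y := by positivity
  have hyk : y * C ^ κ = (2 ^ κ) ^ k := by
    rw [hy, Real.div_rpow (by positivity) hC.le, div_mul_cancel₀ _ hCκ.ne',
      ← Real.rpow_natCast, ← Real.rpow_natCast, ← Real.rpow_mul zero_le_two,
      ← Real.rpow_mul zero_le_two, mul_comm]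
  have hexp := Real.pow_div_factorial_le_exp y hy0 N
  rw [div_le_iff₀ (by positivity)] at hexp
  have hA' : A ^ k ≤ y ^ N * (C ^ κ) ^ N := by
    calc A ^ k ≤ (((2 : ℝ) ^ κ) ^ N) ^ k := by gcongr
      _ = y ^ N * (C ^ κ) ^ N := by rw [← mul_pow, hyk, ← pow_mul, ← pow_mul, mul_comm N]
  rw [Real.exp_neg, ← div_eq_mul_inv, div_le_iff₀ (Real.exp_pos y)]
  calc A ^ k ≤ y ^ N * (C ^ κ) ^ N := hA'
    _ ≤ (Real.exp y * N.factorial) * (C ^ κ) ^ N := by gcongr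
    _ = _ := by ring

theorem sum_range_le_of_le_geometric {t : ℕ → ℝ} {U q r : ℝ} (ht : ∀ j, 0 ≤ t j) (hU : 0 ≤ U)
    (hq0 : 0 ≤ q) (hq1 : q < 1) (hr0 : 0 ≤ r) (hr1 : r < 1) (i : ℕ)
    (hlow : ∀ j k, j + k = i → t j ≤ U * q ^ k) (hup : ∀ k, t (i + k) ≤ U * r ^ k) (n : ℕ) :
    ∑ j ∈ Finset.range n, t j ≤ U * ((1 - q)⁻¹ + (1 - r)⁻¹) := by
  have geom : ∀ {s : ℝ}, 0 ≤ s → s < 1 → ∀ m, ∑ k ∈ Finset.range m, U * s ^ k ≤ U * (1 - s)⁻¹ := by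
    intro s h0 h1 m
    rw [← Finset.mul_sum, ← tsum_geometric_of_lt_one h0 h1]
    exact mul_le_mul_of_nonneg_left
      ((summable_geometric_of_lt_one h0 h1).sum_le_tsum _ fun k _ => pow_nonneg h0 k) hU
  calc ∑ j ∈ Finset.range n, t j ≤ ∑ j ∈ Finset.range (i + n), t j :=
        Finset.sum_le_sum_of_subset_of_nonneg (Finset.range_mono (by omega)) fun j _ _ => ht j
    _ = ∑ j ∈ Finset.range i, t (i - 1 - j) + ∑ k ∈ Finset.range n, t (i + k) := by
        rw [Finset.sum_range_add, Finset.sum_range_reflect]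
    _ ≤ ∑ j ∈ Finset.range i, U * q ^ j + ∑ k ∈ Finset.range n, U * r ^ k := by
        refine add_le_add (Finset.sum_le_sum fun j hj => ?_) (Finset.sum_le_sum fun k _ => hup k)
        have hj := Finset.mem_range.mp hj
        refine (hlow _ (j + 1) (by omega)).trans ?_
        exact mul_le_mul_of_nonneg_left (pow_le_pow_of_le_one hq0 hq1.le (Nat.le_succ j)) hU
    _ ≤ _ := by
        rw [mul_add]
        exact add_le_add (geom hq0 hq1 i) (geom hr0 hr1 n)

/-- The sub-Gaussian bounds at the times `2 ^ j`, weighted by `1 / φ(θ ^ j)` with `θ ^ γ = 2`, add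
up to at most a multiple of the jump kernel. The terms decay geometrically on both sides of the
scale `θ ^ j ≈ d`: for larger `j` because `φ` grows, for smaller `j` by the exponential factor. -/
theorem exists_sum_subGaussian_le {V φ : ℝ → ℝ} {β γ θ C D : ℝ}
    (hφ : IsRegularlyVarying φ β) (hβ : 0 < β)
    (h1 : ∀ t, 0 ≤ t → 1 ≤ φ t) (hc : ContinuousOn φ (Set.Ici 0)) (hγ : 1 < γ)
    (hθ : 1 < θ) (hθ2 : θ ≤ 2) (hθγ : θ ^ γ = 2) (hC : 0 < C)
    (hVpos : ∀ r, 0 ≤ r → 0 < V r) (hVmono : MonotoneOn V (Set.Ici 0))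
    (hD : 1 < D) (hVD : ∀ r, 0 < r → V (2 * r) ≤ D * V r) :
    ∃ C' : ℝ, 0 < C' ∧ ∀ d : ℝ, 1 ≤ d → ∀ n : ℕ,
      ∑ j ∈ Finset.range n, 1 / φ (θ ^ j) * (C / V (θ ^ j) *
        Real.exp (-((d ^ γ / (C * 2 ^ j)) ^ (1 / (γ - 1))))) ≤ C' * (1 / (V d * φ d)) := by
  have hφpos : ∀ t, 0 ≤ t → 0 < φ t := fun t ht => one_pos.trans_le (h1 t ht)
  have hθ0 : 0 < θ := one_pos.trans hθ
  have hκ : 0 < 1 / (γ - 1) := one_div_pos.mpr (by linarith)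
  obtain ⟨M, hM1, hM⟩ := hφ.exists_ratio_le h1 hc θ
  obtain ⟨r, A, hr0, hr1, hA, hgeo⟩ := hφ.exists_le_geometric hβ h1 hθ
  obtain ⟨B, hB, hBk⟩ := exists_pow_mul_exp_neg_rpow_le (A := 2 * (M * D)) (C := C) (by positivity)
    hC hκ
  have hθpos : ∀ j : ℕ, 0 < θ ^ j := fun j => pow_pos hθ0 j
  have hVj : ∀ j : ℕ, 0 < V (θ ^ j) := fun j => hVpos _ (hθpos j).le
  have hφj : ∀ j : ℕ, 0 < φ (θ ^ j) := fun j => hφpos _ (hθpos j).le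
  have hVθ : ∀ s t, 0 < t → 0 ≤ s → s ≤ θ * t → V s ≤ D * V t := fun s t ht hs hst =>
    (hVmono hs (show (0 : ℝ) ≤ 2 * t by positivity)
      (hst.trans (mul_le_mul_of_nonneg_right hθ2 ht.le))).trans (hVD t ht)
  have hφup : ∀ j k, φ (θ ^ (j + k)) ≤ M ^ k * φ (θ ^ j) := by
    intro j k
    induction k with
    | zero => simp
    | succ k ih =>
      have h := (hM (θ ^ (j + (k + 1))) (θ ^ (j + k)) (hθpos _)
        (pow_le_pow_right₀ hθ.le (by omega)) (by rw [← add_assoc, pow_succ'])).1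
      calc _ ≤ _ := h
        _ ≤ M * (M ^ k * φ (θ ^ j)) := by gcongr
        _ = _ := by ring
  have hVup : ∀ j k, V (θ ^ (j + k)) ≤ D ^ k * V (θ ^ j) := by
    intro j k
    induction k with
    | zero => simp
    | succ k ih =>
      have h := hVθ (θ ^ (j + (k + 1))) (θ ^ (j + k)) (hθpos _) (hθpos _).le
        (by rw [← add_assoc, pow_succ'])
      calc _ ≤ _ := h
        _ ≤ D * (D ^ k * V (θ ^ j)) := by gcongr
        _ = _ := by ring
  refine ⟨C * (A + B) * (M * D) * ((1 - 1 / 2)⁻¹ + (1 - r)⁻¹), ?_, fun d hd n => ?_⟩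
  · have : 0 < 1 - r := by linarith
    positivity
  obtain ⟨i, hi, hi'⟩ := exists_nat_pow_near hd hθ
  have hd0 : 0 < d := one_pos.trans_le hd
  have hdγ : 2 ^ i ≤ d ^ γ := by
    calc (2 : ℝ) ^ i = (θ ^ i) ^ γ := by
          rw [← hθγ, ← Real.rpow_natCast, ← Real.rpow_natCast, ← Real.rpow_mul hθ0.le,
            ← Real.rpow_mul hθ0.le, mul_comm]
      _ ≤ d ^ γ := Real.rpow_le_rpow (hθpos i).le hi (by linarith)
  set W : ℝ := 1 / (φ (θ ^ i) * V (θ ^ i)) with hW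
  have hW0 : 0 < W := one_div_pos.mpr (mul_pos (hφj i) (hVj i))
  have hWd : W ≤ M * D * (1 / (V d * φ d)) := by
    have e1 := (hM d (θ ^ i) (hθpos i) hi (by rw [← pow_succ']; exact hi'.le)).1
    have e2 := hVθ d (θ ^ i) (hθpos i) hd0.le (by rw [← pow_succ']; exact hi'.le)
    have hφd := hφpos d hd0.le
    have hVd := hVpos d hd0.le
    rw [hW, mul_one_div, div_le_div_iff₀ (mul_pos (hφj i) (hVj i)) (by positivity)]
    calc 1 * (V d * φ d) ≤ 1 * ((D * V (θ ^ i)) * (M * φ (θ ^ i))) := by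
          have := hVj i
          gcongr
      _ = _ := by ring
  have key := sum_range_le_of_le_geometric (t := fun j => 1 / φ (θ ^ j) * (C / V (θ ^ j) *
    Real.exp (-((d ^ γ / (C * 2 ^ j)) ^ (1 / (γ - 1)))))) (U := C * (A + B) * W) (q := 1 / 2)
    (r := r) (fun j => by have := hφj j; have := hVj j; positivity) (by positivity) (by norm_num)
    (by norm_num) hr0.le hr1 i ?_ ?_ n
  · refine key.trans ?_
    have : 0 < 1 - r := by linarith
    calc C * (A + B) * W * ((1 - 1 / 2)⁻¹ + (1 - r)⁻¹)
        ≤ C * (A + B) * (M * D * (1 / (V d * φ d))) * ((1 - 1 / 2)⁻¹ + (1 - r)⁻¹) := by gcongr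
      _ = _ := by ring
  · rintro j k rfl
    have hφ' := hφj j
    have hV' := hVj j
    have h2 : 1 / φ (θ ^ j) * (1 / V (θ ^ j)) ≤ (M * D) ^ k * W := by
      rw [hW, one_div_mul_one_div, mul_one_div, mul_pow, div_le_div_iff₀ (by positivity)
        (mul_pos (hφj _) (hVj _))]
      calc 1 * (φ (θ ^ (j + k)) * V (θ ^ (j + k)))
          ≤ 1 * ((M ^ k * φ (θ ^ j)) * (D ^ k * V (θ ^ j))) := by
            have := hVj (j + k)
            gcongr
            · exact hφup j k
            · exact hVup j k
        _ = _ := by ring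
    have hexp : Real.exp (-((d ^ γ / (C * 2 ^ j)) ^ (1 / (γ - 1)))) ≤
        Real.exp (-((2 ^ k / C) ^ (1 / (γ - 1)))) := by
      refine Real.exp_le_exp.mpr (neg_le_neg (Real.rpow_le_rpow (by positivity) ?_ hκ.le))
      rw [div_le_div_iff₀ hC (by positivity)]
      calc (2 : ℝ) ^ k * (C * 2 ^ j) = 2 ^ (j + k) * C := by ring
        _ ≤ d ^ γ * C := by gcongr
    have hk := hBk k
    rw [mul_pow, mul_assoc, ← le_div_iff₀' (by positivity)] at hk
    calc _ = C * (1 / φ (θ ^ j) * (1 / V (θ ^ j))) *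
          Real.exp (-((d ^ γ / (C * 2 ^ j)) ^ (1 / (γ - 1)))) := by ring
      _ ≤ C * ((M * D) ^ k * W) * Real.exp (-((2 ^ k / C) ^ (1 / (γ - 1)))) := by gcongr
      _ = C * W * ((M * D) ^ k * Real.exp (-((2 ^ k / C) ^ (1 / (γ - 1))))) := by ring
      _ ≤ C * W * (B / 2 ^ k) := by gcongr
      _ = C * B * W * (1 / 2) ^ k := by rw [one_div_pow]; ring
      _ ≤ _ := by gcongr; linarith
  · intro k
    have hφ' := hφj (i + k)
    have hV' := hVj (i + k)
    have hφi := hφj i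
    have hVi := hVj i
    have h2 : 1 / φ (θ ^ (i + k)) * (1 / V (θ ^ (i + k))) ≤ A * r ^ k * W := by
      rw [hW, one_div_mul_one_div, mul_one_div, div_le_div_iff₀ (by positivity)
        (by positivity)]
      calc 1 * (φ (θ ^ i) * V (θ ^ i))
          ≤ 1 * ((A * r ^ k * φ (θ ^ (i + k))) * V (θ ^ (i + k))) := by
            gcongr
            · exact hgeo i k
            · exact hVmono (hθpos i).le (hθpos _).le (pow_le_pow_right₀ hθ.le (by omega))
        _ = _ := by ring
    calc _ = C * (1 / φ (θ ^ (i + k)) * (1 / V (θ ^ (i + k)))) *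
          Real.exp (-((d ^ γ / (C * 2 ^ (i + k))) ^ (1 / (γ - 1)))) := by ring
      _ ≤ C * (A * r ^ k * W) * 1 := by
          gcongr
          rw [Real.exp_le_one_iff, neg_nonpos]
          positivity
      _ = C * A * W * r ^ k := by ring
      _ ≤ _ := by gcongr; linarith

namespace WeightedGraph

variable {Γ : Type*} {G : WeightedGraph Γ} {f : Γ → ℝ}

/-! ### Comparison of Dirichlet forms -/

theorem SymmMarkov.sum_energy_le {ι : Type*} (s : Finset ι) (b : ι → ℝ) (L : ι → G.SymmMarkov)
    (K : G.SymmMarkov) (C : ℝ) (hpos : ∀ x, 0 < G.mu x)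
    (h : ∀ x y, x ≠ y → ∑ j ∈ s, b j * (L j).ker x y ≤ C * K.ker x y) (hf : G.MemL2 f) :
    ∑ j ∈ s, b j * (L j).energy f ≤ C * K.energy f := by
  have hL := hasSum_sum (s := s) fun j _ => ((L j).hasSum_energy hpos hf).mul_left (b j)
  have hK := (K.hasSum_energy hpos hf).mul_left C
  have := hasSum_le (fun p => ?_) hL hK
  · have e : ∑ j ∈ s, b j * (2 * (L j).energy f) = 2 * ∑ j ∈ s, b j * (L j).energy f := by
      rw [Finset.mul_sum]
      exact Finset.sum_congr rfl fun j _ => by ring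
    rw [e] at this
    linarith
  · by_cases hp : p.1 = p.2
    · simp [hp]
    · simp only [pairWeight]
      have hw : 0 ≤ G.mu p.1 * G.mu p.2 * (f p.1 - f p.2) ^ 2 :=
        mul_nonneg (mul_nonneg (mu_nonneg _) (mu_nonneg _)) (sq_nonneg _)
      calc _ = (∑ j ∈ s, b j * (L j).ker p.1 p.2) *
            (G.mu p.1 * G.mu p.2 * (f p.1 - f p.2) ^ 2) := by
            rw [Finset.sum_mul]
            exact Finset.sum_congr rfl fun j _ => by ring
        _ ≤ C * K.ker p.1 p.2 * (G.mu p.1 * G.mu p.2 * (f p.1 - f p.2) ^ 2) :=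
            mul_le_mul_of_nonneg_right (h _ _ hp) hw
        _ = _ := by ring

theorem d_ne_zero {x y : Γ} (h : x ≠ y) : G.d x y ≠ 0 := fun h0 => by
  rcases SimpleGraph.dist_eq_zero_iff_eq_or_not_reachable.mp h0 with h' | h'
  · exact h h'
  · exact h' (G.connected.preconnected x y)

theorem mem_ball {x y : Γ} {R : ℝ} : y ∈ G.ball x R ↔ (G.d x y : ℝ) ≤ R := by
  simp [ball]

theorem self_mem_ball (x : Γ) {R : ℝ} (hR : 0 ≤ R) : x ∈ G.ball x R := by
  simp [mem_ball, d, hR]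

theorem vol_pos (hpos : ∀ x, 0 < G.mu x) (x : Γ) {R : ℝ} (hR : 0 ≤ R) : 0 < G.vol x R :=
  Finset.sum_pos (fun y _ => hpos y) ⟨x, self_mem_ball x hR⟩

theorem avg_eq_self_of_lt_one (hpos : ∀ x, 0 < G.mu x) (f : Γ → ℝ) {R : ℝ} (hR0 : 0 ≤ R)
    (hR : R < 1) (x : Γ) : G.avg f R x = f x := by
  have hball : G.ball x R = {x} := by
    refine Finset.eq_singleton_iff_unique_mem.mpr ⟨self_mem_ball x hR0, fun y hy => ?_⟩
    by_contra hne
    have h1 : (1 : ℝ) ≤ G.d x y := by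
      exact_mod_cast Nat.one_le_iff_ne_zero.mpr (d_ne_zero (Ne.symm hne))
    linarith [mem_ball.mp hy]
  have := (hpos x).ne'
  simp only [avg, vol, hball, Finset.sum_singleton]
  field_simp

/-- Jensen's inequality for the average over a ball. -/
theorem sq_sub_avg_le (hpos : ∀ x, 0 < G.mu x) (f : Γ → ℝ) {R : ℝ} (hR : 0 ≤ R) (x : Γ) :
    (f x - G.avg f R x) ^ 2 ≤
      ∑ y ∈ G.ball x R, 1 / G.vol x R * ((f x - f y) ^ 2 * G.mu y) := by
  have hv := vol_pos hpos x hR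
  have e : f x - G.avg f R x = (∑ y ∈ G.ball x R, (f x - f y) * G.mu y) / G.vol x R := by
    simp only [sub_mul, Finset.sum_sub_distrib, ← Finset.mul_sum, avg]
    rw [← vol]
    field_simp
  have h := Finset.sum_sq_le_sum_mul_sum_of_sq_le_mul (G.ball x R)
    (r := fun y => (f x - f y) * G.mu y) (f := fun y => G.mu y)
    (g := fun y => (f x - f y) ^ 2 * G.mu y) (fun y _ => (hpos y).le)
    (fun y _ => mul_nonneg (sq_nonneg _) (hpos y).le) fun y _ => le_of_eq (by ring)
  rw [e, ← Finset.mul_sum, div_pow, div_le_iff₀ (by positivity)]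
  rw [← vol] at h
  refine h.trans (le_of_eq ?_)
  field_simp

/-- If the sum of two symmetric Markov kernels dominates the averaging kernel of balls of radius `R`,
then the sum of their Dirichlet forms controls `f - f_R`. Two kernels are needed because the lower
heat kernel bound concerns `p_n + p_{n+1}`. -/
theorem memL2_sub_avg_and_normSq_le (K L : G.SymmMarkov) (hpos : ∀ x, 0 < G.mu x) {R C : ℝ}
    (hR : 0 ≤ R) (hC : 0 ≤ C)
    (h : ∀ x y, (G.d x y : ℝ) ≤ R → 1 / G.vol x R ≤ C * (K.ker x y + L.ker x y))
    (hf : G.MemL2 f) :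
    G.MemL2 (fun x => f x - G.avg f R x) ∧
      G.normSq (fun x => f x - G.avg f R x) ≤ 2 * C * (K.energy f + L.energy f) := by
  have hs := ((K.hasSum_energy hpos hf).add (L.hasSum_energy hpos hf)).mul_left C
  have hle : ∀ x, (f x - G.avg f R x) ^ 2 * G.mu x ≤ ∑' y, C * (K.pairWeight (x, y) *
      (f x - f y) ^ 2 + L.pairWeight (x, y) * (f x - f y) ^ 2) := fun x => by
    calc _ ≤ (∑ y ∈ G.ball x R, 1 / G.vol x R * ((f x - f y) ^ 2 * G.mu y)) * G.mu x :=
          mul_le_mul_of_nonneg_right (sq_sub_avg_le hpos f hR x) (mu_nonneg x)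
      _ ≤ ∑ y ∈ G.ball x R, C * (K.pairWeight (x, y) *
            (f x - f y) ^ 2 + L.pairWeight (x, y) * (f x - f y) ^ 2) := by
          rw [Finset.sum_mul]
          refine Finset.sum_le_sum fun y hy => ?_
          have hw : 0 ≤ (f x - f y) ^ 2 * G.mu y * G.mu x :=
            mul_nonneg (mul_nonneg (sq_nonneg _) (mu_nonneg y)) (mu_nonneg x)
          have := mul_le_mul_of_nonneg_right (h x y (mem_ball.mp hy)) hw
          simp only [SymmMarkov.pairWeight]
          linarith
      _ ≤ _ := (hs.summable.prod_factor x).sum_le_tsum _ fun y _ => mul_nonneg hC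
          (add_nonneg (mul_nonneg (K.pairWeight_nonneg _) (sq_nonneg _))
            (mul_nonneg (L.pairWeight_nonneg _) (sq_nonneg _)))
  have hmem : G.MemL2 (fun x => f x - G.avg f R x) :=
    Summable.of_nonneg_of_le (fun x => mul_nonneg (sq_nonneg _) (mu_nonneg x)) hle
      hs.summable.prod
  refine ⟨hmem, ?_⟩
  have e := hs.tsum_eq
  rw [hs.summable.tsum_prod] at e
  calc _ ≤ _ := hmem.tsum_le_tsum hle hs.summable.prod
    _ = C * (2 * K.energy f + 2 * L.energy f) := e
    _ = _ := by ring

/-- The `n`-step walk and the `(n + 1)`-step walk, with `n = 2 ^ J ≈ R ^ γ`, control `f - f_R`. -/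
theorem exists_normSq_sub_avg_le {V : ℝ → ℝ} {γ θ : ℝ} (hpos : ∀ x, 0 < G.mu x)
    (hvol : G.UniformVolumeDoubling V) (hlower : G.SubGaussianLower V γ) (hγ : 1 < γ)
    (hθ : θ = 2 ^ (1 / γ)) :
    ∃ C : ℝ, 0 < C ∧ ∀ (R : ℝ) (J : ℕ), 1 ≤ R → R ^ γ ≤ 2 ^ J → θ ^ J ≤ 2 * R →
      ∀ f : Γ → ℝ, G.MemL2 f → G.MemL2 (fun x => f x - G.avg f R x) ∧
        G.normSq (fun x => f x - G.avg f R x) ≤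
          C * ((walk hpos (2 ^ J)).energy f + (walk hpos (2 ^ J + 1)).energy f) := by
  obtain ⟨c, hc, hlow⟩ := hlower
  obtain ⟨D, hD, hVD⟩ := hvol.doubling
  obtain ⟨H, hH, hVH⟩ := hvol.homogeneous
  have hκ : 0 < 1 / (γ - 1) := one_div_pos.mpr (by linarith)
  have hθ0 : 0 < θ := hθ ▸ Real.rpow_pos_of_pos two_pos _
  set ε : ℝ := Real.exp (-((1 / c) ^ (1 / (γ - 1)))) with hε
  have hε0 : 0 < ε := Real.exp_pos _
  refine ⟨2 * (H * D / (c * ε)), by positivity, fun R J hR hRJ hJR f hf => ?_⟩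
  have hR0 : 0 < R := one_pos.trans_le hR
  refine memL2_sub_avg_and_normSq_le _ _ hpos hR0.le (by positivity) (fun x y hxy => ?_) hf
  have hV0 : 0 < V R := hvol.pos R hR0.le
  have hVJ : 0 < V (θ ^ J) := hvol.pos _ (by positivity)
  have hVle : V (θ ^ J) ≤ D * V R :=
    (hvol.strictMono.monotoneOn (show (0 : ℝ) ≤ θ ^ J by positivity)
      (show (0 : ℝ) ≤ 2 * R by positivity) hJR).trans (hVD R hR0)
  have hvolx : V R ≤ H * G.vol x R := by
    have := (hVH x R hR0).1
    rwa [inv_mul_le_iff₀ (by linarith)] at this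
  have hd : G.d x y ≤ 2 ^ J := by
    have : (G.d x y : ℝ) ≤ 2 ^ J := hxy.trans ((Real.self_le_rpow_of_one_le hR hγ.le).trans hRJ)
    exact_mod_cast this
  have hθJ : (((2 ^ J : ℕ) : ℝ)) ^ (1 / γ) = θ ^ J := by
    rw [hθ]
    push_cast
    rw [← Real.rpow_natCast, ← Real.rpow_natCast, ← Real.rpow_mul zero_le_two,
      ← Real.rpow_mul zero_le_two, mul_comm]
  have h := hlow x y (2 ^ J) Nat.one_le_two_pow hd
  rw [hθJ] at h
  have hexp : ε ≤ Real.exp (-(((G.d x y : ℝ) ^ γ / (c * (2 ^ J : ℕ))) ^ (1 / (γ - 1)))) := by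
    refine Real.exp_le_exp.mpr (neg_le_neg (Real.rpow_le_rpow (by positivity) ?_ hκ.le))
    have hdγ : (G.d x y : ℝ) ^ γ ≤ 2 ^ J :=
      (Real.rpow_le_rpow (Nat.cast_nonneg _) hxy (by linarith)).trans hRJ
    push_cast
    rw [div_le_div_iff₀ (by positivity) hc]
    nlinarith
  have hker : c / V (θ ^ J) * ε ≤ (walk hpos (2 ^ J)).ker x y + (walk hpos (2 ^ J + 1)).ker x y :=
    le_trans (by gcongr) h
  have hvx := vol_pos hpos x hR0.le
  calc 1 / G.vol x R ≤ H * D / V (θ ^ J) := by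
        rw [div_le_div_iff₀ hvx hVJ]
        nlinarith
    _ = H * D / (c * ε) * (c / V (θ ^ J) * ε) := by field_simp
    _ ≤ _ := by gcongr

/-- The dyadic walks, weighted by `1 / φ(θ ^ j)`, are dominated in the sense of Dirichlet forms by
any operator satisfying `(J_φ)`, uniformly in the number of scales. -/
theorem exists_sum_energy_walk_le {V φ : ℝ → ℝ} {β γ θ : ℝ} {K : G.SymmMarkov}
    (hpos : ∀ x, 0 < G.mu x) (hvol : G.UniformVolumeDoubling V) (hγ : 1 < γ)
    (hupper : G.SubGaussianUpper V γ) (h1 : ∀ t, 0 ≤ t → 1 ≤ φ t)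
    (hc : ContinuousOn φ (Set.Ici 0)) (hβ : 0 < β) (hφ : IsRegularlyVarying φ β)
    (hK : K.JumpCondition V φ) (hθ : θ = 2 ^ (1 / γ)) :
    ∃ C : ℝ, 0 < C ∧ ∀ (n : ℕ) (f : Γ → ℝ), G.MemL2 f →
      ∑ j ∈ Finset.range n, 1 / φ (θ ^ j) * (walk hpos (2 ^ j)).energy f ≤ C * K.energy f := by
  obtain ⟨C, hC, hup⟩ := hupper
  obtain ⟨D, hD, hVD⟩ := hvol.doubling
  obtain ⟨Q, hQ, hKQ⟩ := hK
  have hγ0 : 0 < γ := one_pos.trans hγ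
  have hθ1 : 1 < θ := hθ ▸ Real.one_lt_rpow one_lt_two (by positivity)
  have hθ2 : θ ≤ 2 := by
    rw [hθ]
    exact Real.rpow_le_self_of_one_le one_le_two ((div_le_one hγ0).mpr hγ.le)
  have hθγ : θ ^ γ = 2 := by
    rw [hθ, ← Real.rpow_mul zero_le_two, one_div_mul_cancel hγ0.ne', Real.rpow_one]
  obtain ⟨C', hC', hsum⟩ := exists_sum_subGaussian_le hφ hβ h1 hc hγ hθ1 hθ2 hθγ hC hvol.pos
    hvol.strictMono.monotoneOn hD hVD
  refine ⟨C' * Q, by positivity, fun n f hf => ?_⟩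
  refine SymmMarkov.sum_energy_le _ _ _ K _ hpos (fun x y hxy => ?_) hf
  have hd : (1 : ℝ) ≤ G.d x y := by
    exact_mod_cast Nat.one_le_iff_ne_zero.mpr (d_ne_zero hxy)
  have hk := (hKQ x y).1
  rw [inv_mul_le_iff₀ hQ] at hk
  calc _ ≤ ∑ j ∈ Finset.range n, 1 / φ (θ ^ j) * (C / V (θ ^ j) *
        Real.exp (-(((G.d x y : ℝ) ^ γ / (C * 2 ^ j)) ^ (1 / (γ - 1))))) := by
        refine Finset.sum_le_sum fun j _ => ?_
        have hθj : (((2 ^ j : ℕ) : ℝ)) ^ (1 / γ) = θ ^ j := by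
          rw [hθ]
          push_cast
          rw [← Real.rpow_natCast, ← Real.rpow_natCast, ← Real.rpow_mul zero_le_two,
            ← Real.rpow_mul zero_le_two, mul_comm]
        have h := hup x y (2 ^ j) Nat.one_le_two_pow
        rw [hθj] at h
        push_cast at h
        have : 0 ≤ 1 / φ (θ ^ j) :=
          one_div_nonneg.mpr (zero_le_one.trans (h1 _ (by positivity)))
        exact mul_le_mul_of_nonneg_left h this
    _ ≤ C' * (1 / (V (G.d x y) * φ (G.d x y))) := hsum _ hd n
    _ ≤ C' * (Q * K.ker x y) := by gcongr
    _ = _ := by ring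

end WeightedGraph

/-! ### The pseudo-Poincaré inequality -/

theorem mainTheorem3 {Γ : Type*} [Infinite Γ] (G : WeightedGraph Γ)
    (V : ℝ → ℝ) (γ : ℝ) (φ : ℝ → ℝ) (β : ℝ) (K : G.SymmMarkov)
    (hcount : G.ComparableToCounting)
    (hvol : G.UniformVolumeDoubling V)
    (hγ : 1 < γ)
    (hupper : G.SubGaussianUpper V γ)
    (hlower : G.SubGaussianLower V γ)
    (hφ_one : ∀ t, 0 ≤ t → 1 ≤ φ t)
    (hφ_cont : ContinuousOn φ (Set.Ici 0))
    (hβ : 0 < β)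
    (hφ_reg : IsRegularlyVarying φ β)
    (hK : K.JumpCondition V φ) :
    ∃ C : ℝ, 0 < C ∧ ∀ R : ℝ, 0 < R → ∀ f : Γ → ℝ, G.MemL2 f →
      G.MemL2 (fun x => f x - G.avg f R x) ∧
        G.normSq (fun x => f x - G.avg f R x) ≤
          C * (R ^ γ / ∫ s in (0 : ℝ)..R, s ^ (γ - 1) / φ s) * K.energy f := by
  have hpos : ∀ x, 0 < G.mu x := by
    obtain ⟨C, hC, h⟩ := hcount
    exact fun x => (inv_pos.mpr (one_pos.trans_le hC)).trans_le (h x).1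
  have hγ0 : 0 < γ := one_pos.trans hγ
  have hφpos : ∀ t, 0 ≤ t → 0 < φ t := fun t ht => one_pos.trans_le (hφ_one t ht)
  -- the scale factor that corresponds to doubling the time
  obtain ⟨θ, hθ⟩ : ∃ θ : ℝ, θ = 2 ^ (1 / γ) := ⟨_, rfl⟩
  have hθ1 : 1 < θ := hθ ▸ Real.one_lt_rpow one_lt_two (by positivity)
  have hθ0 : 0 < θ := one_pos.trans hθ1
  have hθ2 : θ ≤ 2 := by
    rw [hθ]
    exact Real.rpow_le_self_of_one_le one_le_two ((div_le_one hγ0).mpr hγ.le)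
  have hθγ : θ ^ γ = 2 := by
    rw [hθ, ← Real.rpow_mul zero_le_two, one_div_mul_cancel hγ0.ne', Real.rpow_one]
  have hθpow : ∀ j : ℕ, (θ ^ j) ^ γ = 2 ^ j := fun j => by
    rw [← hθγ, ← Real.rpow_natCast, ← Real.rpow_natCast, ← Real.rpow_mul hθ0.le,
      ← Real.rpow_mul hθ0.le, mul_comm]
  obtain ⟨C₁, hC₁, hint⟩ := exists_integral_le_sum hφ_reg hφ_one hφ_cont hγ hθ1 hθγ
  obtain ⟨C₂, hC₂, hsum⟩ := WeightedGraph.exists_sum_energy_walk_le hpos hvol hγ hupper hφ_one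
    hφ_cont hβ hφ_reg hK hθ
  obtain ⟨C₃, hC₃, hosc⟩ := WeightedGraph.exists_normSq_sub_avg_le hpos hvol hlower hγ hθ
  have hφ1 := hφpos 1 zero_le_one
  set A : ℝ := C₃ * (3 * C₂ + 4 * (φ 1 * C₂)) with hA
  refine ⟨2 * A * C₁, by positivity, fun R hR f hf => ?_⟩
  have hE := K.energy_nonneg hpos hf
  rcases lt_or_ge R 1 with hR1 | hR1
  · -- balls of radius less than one are singletons
    simp only [WeightedGraph.avg_eq_self_of_lt_one hpos f hR.le hR1, sub_self]
    have hI : 0 ≤ ∫ s in (0 : ℝ)..R, s ^ (γ - 1) / φ s :=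
      intervalIntegral.integral_nonneg hR.le fun s hs =>
        div_nonneg (Real.rpow_nonneg hs.1 _) (hφpos s hs.1).le
    refine ⟨by simp [WeightedGraph.MemL2, summable_zero], ?_⟩
    have h0 : G.normSq (fun _ => 0) = 0 := by simp [WeightedGraph.normSq]
    rw [h0]
    positivity
  obtain ⟨m, hm, hm'⟩ := exists_nat_pow_near hR1 hθ1
  obtain ⟨J, hJ⟩ : ∃ J, J = m + 1 := ⟨_, rfl⟩
  rw [← hJ] at hm'
  have hRJ : R ^ γ ≤ 2 ^ J := by
    rw [← hθpow]
    exact Real.rpow_le_rpow hR.le hm'.le hγ0.le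
  have hJR : (2 : ℝ) ^ J ≤ 2 * R ^ γ := by
    rw [hJ, pow_succ', ← hθpow]
    have := Real.rpow_le_rpow (by positivity) hm hγ0.le
    linarith
  have hθJ : θ ^ J ≤ 2 * R := by
    rw [hJ, pow_succ']
    exact mul_le_mul hθ2 hm (by positivity) zero_le_two
  obtain ⟨hmem, hN⟩ := hosc R J hR1 hRJ hθJ f hf
  refine ⟨hmem, hN.trans ?_⟩
  set E : ℕ → ℝ := fun n => (WeightedGraph.walk hpos n).energy f with hEdef
  have hE0 : ∀ n, 0 ≤ E n := fun n => WeightedGraph.SymmMarkov.energy_nonneg _ hpos hf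
  set S : ℝ := ∑ j ∈ Finset.range (J + 1), 2 ^ j / φ (θ ^ j) with hS
  set I : ℝ := ∫ s in (0 : ℝ)..R, s ^ (γ - 1) / φ s with hIdef
  have hcont : ContinuousOn (fun s => s ^ (γ - 1) / φ s) (Set.Ici 0) :=
    (Real.continuous_rpow_const (by linarith)).continuousOn.div hφ_cont fun t ht => (hφpos t ht).ne'
  have hintv : ∀ a b, 0 ≤ a → 0 ≤ b →
      IntervalIntegrable (fun s => s ^ (γ - 1) / φ s) MeasureTheory.volume a b := fun a b ha hb =>
    (hcont.mono fun x hx => (le_min ha hb).trans hx.1).intervalIntegrable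
  have hI0 : 0 < I := intervalIntegral.intervalIntegral_pos_of_pos_on (hintv 0 R le_rfl hR.le)
    (fun s hs => div_pos (Real.rpow_pos_of_pos hs.1 _) (hφpos s hs.1.le)) hR
  have hIS : I ≤ C₁ * S := by
    refine le_trans ?_ (hint J)
    rw [← intervalIntegral.integral_add_adjacent_intervals (hintv 0 R le_rfl hR.le)
      (hintv R (θ ^ J) hR.le (by positivity))]
    have : 0 ≤ ∫ s in R..θ ^ J, s ^ (γ - 1) / φ s :=
      intervalIntegral.integral_nonneg hm'.le fun s hs =>
        div_nonneg (Real.rpow_nonneg (hR.le.trans hs.1) _) (hφpos s (hR.le.trans hs.1)).le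
    linarith
  -- the form at time `2 ^ J`, weighted by all the scales below it
  have hSE : S * E (2 ^ J) ≤ 2 ^ J * (C₂ * K.energy f) := by
    refine le_trans ?_ (mul_le_mul_of_nonneg_left (hsum (J + 1) f hf) (by positivity))
    rw [hS, Finset.sum_mul, Finset.mul_sum]
    refine Finset.sum_le_sum fun j hj => ?_
    obtain ⟨k, rfl⟩ := Nat.exists_eq_add_of_le (Nat.lt_succ_iff.mp (Finset.mem_range.mp hj))
    have h := WeightedGraph.energy_walk_two_pow_le hpos hf j k
    have hφj := hφpos (θ ^ j) (by positivity)
    calc 2 ^ j / φ (θ ^ j) * E (2 ^ (j + k)) ≤ 2 ^ j / φ (θ ^ j) * (2 ^ k * E (2 ^ j)) := by gcongr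
      _ = _ := by rw [pow_add]; ring
  have hE1 : E 1 ≤ φ 1 * (C₂ * K.energy f) := by
    have h := hsum 1 f hf
    simp only [Finset.range_one, Finset.sum_singleton, pow_zero] at h
    rwa [one_div, inv_mul_le_iff₀ hφ1] at h
  have hS2 : S ≤ 2 * 2 ^ J := by
    have h : S ≤ ∑ j ∈ Finset.range (J + 1), (2 : ℝ) ^ j := Finset.sum_le_sum fun j _ =>
      div_le_self (by positivity) (hφ_one _ (by positivity))
    rw [geom_sum_eq (by norm_num), pow_succ'] at h
    linarith
  have hS0 : 0 < S := Finset.sum_pos (fun j _ => div_pos (by positivity) (hφpos _ (by positivity)))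
    ⟨0, by simp⟩
  have hadd : E (2 ^ J + 1) ≤ 2 * E 1 + 2 * E (2 ^ J) :=
    WeightedGraph.energy_walk_add_le hpos (2 ^ J) 1 hf
  have hmain : C₃ * (E (2 ^ J) + E (2 ^ J + 1)) * S ≤ A * 2 ^ J * K.energy f := by
    have h1 : S * E 1 ≤ 2 * 2 ^ J * (φ 1 * (C₂ * K.energy f)) :=
      mul_le_mul hS2 hE1 (hE0 1) (by positivity)
    calc C₃ * (E (2 ^ J) + E (2 ^ J + 1)) * S
        ≤ C₃ * (E (2 ^ J) + (2 * E 1 + 2 * E (2 ^ J))) * S := by gcongr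
      _ = C₃ * (3 * (S * E (2 ^ J)) + 2 * (S * E 1)) := by ring
      _ ≤ C₃ * (3 * (2 ^ J * (C₂ * K.energy f)) +
          2 * (2 * 2 ^ J * (φ 1 * (C₂ * K.energy f)))) := by gcongr
      _ = _ := by rw [hA]; ring
  have hA0 : 0 < A := by positivity
  calc C₃ * (E (2 ^ J) + E (2 ^ J + 1)) ≤ A * 2 ^ J * K.energy f / S := (le_div_iff₀ hS0).mpr hmain
    _ ≤ A * (2 * R ^ γ) * K.energy f * (C₁ / I) := by
        rw [div_eq_mul_one_div]
        have : 1 / S ≤ C₁ / I := by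
          rw [div_le_div_iff₀ hS0 hI0]; linarith
        gcongr
    _ = _ := by ring
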